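/- Let $\mathbb{Q}^{\mathrm{ab}}\subset\mathbb{C}$ be the maximal abelian extension of $\mathbb{Q}$. For a number field $K$ let $\mathbb{P}_K$ be the set of nonzero prime ideals of its ring of integers $\mathcal{O}_K$. For each $\mathfrak{q}\in\mathbb{P}_K$ take an infinite set of variables $\mathfrak{X}^{(\mathfrak{q})}=(x_1^{(\mathfrak{q})},x_2^{(\mathfrak{q})},\dots)$, write $\mathfrak{X}_K=(\mathfrak{X}^{(\mathfrak{q})})_{\mathfrak{q}\in\mathbb{P}_K}$, and let $A_K=\bigotimes_{\mathfrak{q}\in\mathbb{P}_K}\Lambda[\mathfrak{X}^{(\mathfrak{q})}]$ be the (restricted) tensor product of the rings of symmetric functions over $\mathbb{Q}^{\mathrm{ab}}$. It is multigraded by the degrees in the $\mathfrak{X}^{(\mathfrak{q})}$. Let $\mathcal{A}_K$ be its completion, the ring of formal sums $\sum_d F_d$ over finitely supported $d:\mathbb{P}_K\to\mathbb{Z}_{\ge 0}$ with $F_d\in A_K$ homogeneous of degree $d(\mathfrak{q})$ in $\mathfrak{X}^{(\mathfrak{q})}$ for every $\mathfrak{q}$; equivalently, the ring of formal power series over $\mathbb{Q}^{\mathrm{ab}}$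 in all variables $x_i^{(\mathfrak{q})}$ that are symmetric in each $\mathfrak{X}^{(\mathfrak{q})}$. For a finite extension $L/K$ of number fields, the norm map $\mathcal{N}_{L/K}:\mathcal{A}_L\to\mathcal{A}_K$ is the $\mathbb{Q}^{\mathrm{ab}}$-algebra homomorphism given by the substitution $\mathfrak{X}^{(\mathfrak{p})}\mapsto p_{f(\mathfrak{p}|\mathfrak{q})}[\mathfrak{X}^{(\mathfrak{q})}]$, that is $x_i^{(\mathfrak{p})}\mapsto (x_i^{(\mathfrak{q})})^{f(\mathfrak{p}|\mathfrak{q})}$ for all $i$, where $\mathfrak{q}=\mathfrak{p}\cap\mathcal{O}_K$ and $f(\mathfrak{p}|\mathfrak{q})=[\mathcal{O}_L/\mathfrak{p}:\mathcal{O}_K/\mathfrak{q}]$. Let $L/K$ be a finite Galois extension of number fields and let $\rho:\mathrm{Gal}(L/K)\to\mathrm{GL}(V)$ be a finite-dimensional complex representation. For each $\mathfrak{q}\in\mathbb{P}_K$ choose a prime $\mathfrak{p}$ of $L$ above $\mathfrak{q}$, let $I(\mathfrak{q})$ be its inertia group, and choose a Frobenius element $\sigma_{\mathfrak{q}}\in\mathrm{Gal}(L/K)$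 at $\mathfrak{p}$, that is $\sigma_{\mathfrak{q}}(x)\equiv x^{\#(\mathcal{O}_K/\mathfrak{q})} \pmod{\mathfrak{p}}$ for all $x\in\mathcal{O}_L$. The Artin symmetric function of $\rho$ is $$\mathscr{L}(\mathfrak{X}_K,\rho;L/K)=\prod_{\mathfrak{q}\in\mathbb{P}_K}\prod_{i\ge 1}\det\bigl(\mathrm{Id}-x_i^{(\mathfrak{q})}\rho(\sigma_{\mathfrak{q}})\big|_{V^{I(\mathfrak{q})}}\bigr)^{-1}\in\mathcal{A}_K .$$ **Proposition.** Let $E/L/K$ be a tower of finite Galois extensions of number fields ($E/K$ and $L/K$, hence also $E/L$, are Galois). Let $\rho,\gamma$ be finite-dimensional complex representations of $\mathrm{Gal}(L/K)$ and let $\rho_0$ be a finite-dimensional complex representation of $\mathrm{Gal}(E/L)$. Then, for all choices of primes and Frobenius elements made in defining each of the Artin symmetric functions below (independently of each other), 1. $\mathscr{L}(\mathfrak{X}_K,\rho;L/K)\,\mathscr{L}(\mathfrak{X}_K,\gamma;L/K)=\mathscr{L}(\mathfrak{X}_K,\rho\oplus\gamma;L/K)$; 2. $\mathscr{L}(\mathfrak{X}_K,\rho;L/K)=\mathscr{L}(\mathfrak{X}_K,\iota(\rho);E/K)$,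 where $\iota(\rho)$ is the inflation of $\rho$ along the restriction map $\mathrm{Gal}(E/K)\to\mathrm{Gal}(L/K)$; 3. $\mathcal{N}_{L/K}\bigl(\mathscr{L}(\mathfrak{X}_L,\rho_0;E/L)\bigr)=\mathscr{L}\bigl(\mathfrak{X}_K,\mathrm{Ind}_{\mathrm{Gal}(E/L)}^{\mathrm{Gal}(E/K)}(\rho_0);E/K\bigr)$. -/

import Mathlib

open scoped NumberField Polynomial
open IsDedekindDomain Representation

noncomputable section

namespace ArithSym

/-! ### The coefficient field -/

/-- `ℚ^ab`: the maximal abelian extension of `ℚ`, realised inside `ℂ` as the compositum of all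
finite abelian extensions of `ℚ`. -/
def QAb : IntermediateField ℚ ℂ :=
  ⨆ F : {F : IntermediateField ℚ ℂ // FiniteDimensional ℚ F ∧ IsAbelianGalois ℚ F}, F.1

theorem mem_QAb_of_pow_eq_one {z : ℂ} {n : ℕ} (hn : 0 < n) (hz : z ^ n = 1) : z ∈ QAb := by
  have hm : 0 < orderOf z := orderOf_pos_iff.mpr (isOfFinOrder_iff_pow_eq_one.mpr ⟨n, hn, hz⟩)
  have : NeZero (orderOf z) := ⟨hm.ne'⟩
  have hprim : IsPrimitiveRoot z (orderOf z) := IsPrimitiveRoot.orderOf z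
  have hcyc : IsCyclotomicExtension {orderOf z} ℚ (IntermediateField.adjoin ℚ {z}) :=
    (IntermediateField.isCyclotomicExtension_singleton_iff_eq_adjoin (orderOf z) ℚ ℂ _ hprim).mpr
      rfl
  have hab : IsAbelianGalois ℚ (IntermediateField.adjoin ℚ {z}) :=
    IsCyclotomicExtension.isAbelianGalois {orderOf z} ℚ _
  have hfin : FiniteDimensional ℚ (IntermediateField.adjoin ℚ {z}) :=
    IsCyclotomicExtension.finiteDimensional {orderOf z} ℚ _
  have hle : IntermediateField.adjoin ℚ {z} ≤ QAb :=
    le_iSup (fun F : {F : IntermediateField ℚ ℂ //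
      FiniteDimensional ℚ F ∧ IsAbelianGalois ℚ F} => F.1) ⟨_, hfin, hab⟩
  exact hle (IntermediateField.mem_adjoin_simple_self ℚ z)

/-! ### Power series that are symmetric in each block of variables -/

/-- The power series over `R` in the variables `x_i^{(q)}`, `q : P`, `i : ℕ`, which are symmetric
in each block of variables `X^{(q)} = (x_i^{(q)})_i`: they are fixed by every family of
permutations, the `q`-th one permuting the block `X^{(q)}`. The part of such a series which is
homogeneous of degree `d q` in `X^{(q)}` for all `q`, where `d : P →₀ ℕ`, is a finite `R`-linear
combination of products `∏ q, m_{λ q}[X^{(q)}]` of monomial symmetric functions with `|λ q| = d q`.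
So this is the ring of all formal sums `∑ d, F d` with `F d` an element of multidegree `d`
of `⨂ q, Λ_R[X^{(q)}]`. -/
def blockSymmetric (P R : Type*) [CommRing R] : Subalgebra R (MvPowerSeries (P × ℕ) R) where
  carrier := {F | ∀ τ : P → Equiv.Perm ℕ,
    MvPowerSeries.rename (Equiv.prodCongrRight τ) F = F}
  mul_mem' ha hb τ := by rw [map_mul, ha τ, hb τ]
  add_mem' ha hb τ := by rw [map_add, ha τ, hb τ]
  algebraMap_mem' r τ := AlgHom.commutes _ r

/-- The ring `𝒜_K` of arithmetic symmetric functions of the number field `K`: the completion of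
`A_K = ⨂ q, Λ[X^{(q)}]`, with `q` running over the nonzero primes of `𝓞 K` and with coefficients
in `ℚ^ab`. The multidegree `d` corresponds to the integral ideal `∏ q, q ^ d q`. -/
abbrev ArithRing (K : Type*) [Field K] [NumberField K] :
    Subalgebra QAb (MvPowerSeries (HeightOneSpectrum (𝓞 K) × ℕ) QAb) :=
  blockSymmetric (HeightOneSpectrum (𝓞 K)) QAb

/-! ### The norm map -/

section Norm

variable (K L : Type*) [Field K] [NumberField K] [Field L] [NumberField L] [Algebra K L]

/-- The substitution `X^{(p)} ↦ p_f[X^{(q)}]`, i.e. `x_i^{(p)} ↦ (x_i^{(q)}) ^ f` for all `i`,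
where `q = p ∩ 𝓞 K` and `f = f(p|q)` is the inertia degree. -/
def normSubst (v : HeightOneSpectrum (𝓞 L) × ℕ) :
    MvPowerSeries (HeightOneSpectrum (𝓞 K) × ℕ) QAb :=
  MvPowerSeries.X (v.1.under (𝓞 K), v.2) ^ v.1.asIdeal.inertiaDeg (𝓞 K)

theorem finite_under_fiber (q : HeightOneSpectrum (𝓞 K)) :
    {p : HeightOneSpectrum (𝓞 L) | p.under (𝓞 K) = q}.Finite := by
  have : q.asIdeal.IsMaximal := q.isMaximal
  refine Set.Finite.of_finite_image
    ((IsDedekindDomain.primesOver_finite q.asIdeal (𝓞 L)).subset ?_)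
    (f := HeightOneSpectrum.asIdeal) (fun a _ b _ h => HeightOneSpectrum.ext h)
  rintro _ ⟨p, rfl, rfl⟩
  exact ⟨p.isPrime, ⟨rfl⟩⟩

theorem hasSubst_normSubst : MvPowerSeries.HasSubst (normSubst K L) where
  const_coeff v := by
    have h : v.1.asIdeal.inertiaDeg (𝓞 K) ≠ 0 := (Ideal.inertiaDeg_pos _ _).ne'
    simp [normSubst, h]
  coeff_zero d := by
    classical
    have hfin : (⋃ w ∈ (d.support : Set (HeightOneSpectrum (𝓞 K) × ℕ)),
        {p : HeightOneSpectrum (𝓞 L) | p.under (𝓞 K) = w.1} ×ˢ ({w.2} : Set ℕ)).Finite :=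
      d.support.finite_toSet.biUnion fun w _ =>
        (finite_under_fiber K L w.1).prod (Set.finite_singleton _)
    refine hfin.subset fun v hv => ?_
    have h : v.1.asIdeal.inertiaDeg (𝓞 K) ≠ 0 := (Ideal.inertiaDeg_pos _ _).ne'
    have hd : d = Finsupp.single (v.1.under (𝓞 K), v.2) (v.1.asIdeal.inertiaDeg (𝓞 K)) := by
      by_contra hne
      exact hv (by simp [normSubst, MvPowerSeries.coeff_X_pow, hne])
    simp only [Set.mem_iUnion]
    refine ⟨(v.1.under (𝓞 K), v.2), ?_, ?_⟩
    · rw [hd, Finset.mem_coe, Finsupp.mem_support_iff, Finsupp.single_eq_same]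
      exact h
    · simp

theorem subst_normSubst_mem (F : ArithRing L) :
    MvPowerSeries.substAlgHom (R := QAb) (hasSubst_normSubst K L) F.1 ∈ ArithRing K := by
  intro τ
  have hF : MvPowerSeries.rename
      (Equiv.prodCongrRight fun p : HeightOneSpectrum (𝓞 L) => τ (p.under (𝓞 K))) F.1 = F.1 :=
    F.2 fun p => τ (p.under (𝓞 K))
  rw [MvPowerSeries.rename_eq_subst] at hF
  rw [MvPowerSeries.rename_eq_subst,
    MvPowerSeries.substAlgHom_apply,
    MvPowerSeries.subst_comp_subst_apply (hasSubst_normSubst K L) (MvPowerSeries.HasSubst.X_comp _)]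
  conv_rhs => rw [← hF, MvPowerSeries.subst_comp_subst_apply (MvPowerSeries.HasSubst.X_comp _)
    (hasSubst_normSubst K L)]
  congr 1
  funext v
  rw [Function.comp_apply, MvPowerSeries.subst_X (hasSubst_normSubst K L)]
  unfold normSubst
  rw [MvPowerSeries.subst_pow (MvPowerSeries.HasSubst.X_comp _),
    MvPowerSeries.subst_X (MvPowerSeries.HasSubst.X_comp _)]
  rfl

/-- The norm map `𝒩_{L/K} : 𝒜_L → 𝒜_K`. -/
def normMap : ArithRing L →ₐ[QAb] ArithRing K :=
  ((MvPowerSeries.substAlgHom (R := QAb) (hasSubst_normSubst K L)).comp (ArithRing L).val).codRestrict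
    (ArithRing K) (subst_normSubst_mem K L)

end Norm

/-! ### Infinite products of power series in distinct variables -/

section Product

open scoped MvPowerSeries.WithPiTopology

variable {P k : Type*} [Field k]

/-- `∏ q, ∏ i, (f q)(x_i^{(q)})⁻¹`, an infinite product of formal power series, for the topology of
coefficientwise convergence where the coefficient field is discrete. -/
def eulerProd (f : P → k[X]) : MvPowerSeries (P × ℕ) k :=
  letI : TopologicalSpace k := ⊥
  ∏' v : P × ℕ, (Polynomial.aeval (MvPowerSeries.X v : MvPowerSeries (P × ℕ) k) (f v.1))⁻¹

variable {f : P → k[X]}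

theorem constantCoeff_aeval_X {σ : Type*} (p : k[X]) (v : σ) :
    MvPowerSeries.constantCoeff (Polynomial.aeval (MvPowerSeries.X v : MvPowerSeries σ k) p) =
      p.coeff 0 := by
  rw [Polynomial.aeval_def, Polynomial.hom_eval₂, MvPowerSeries.constantCoeff_X,
    Polynomial.eval₂_at_zero]
  simp [MvPowerSeries.algebraMap_apply]

theorem X_dvd_inv_aeval_sub_one {σ : Type*} (p : k[X]) (hp : p.coeff 0 = 1) (v : σ) :
    (MvPowerSeries.X v : MvPowerSeries σ k) ∣
      (Polynomial.aeval (MvPowerSeries.X v : MvPowerSeries σ k) p)⁻¹ - 1 := by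
  set a := Polynomial.aeval (MvPowerSeries.X v : MvPowerSeries σ k) p with ha
  have hc : MvPowerSeries.constantCoeff a ≠ 0 := by
    rw [ha, constantCoeff_aeval_X, hp]; exact one_ne_zero
  have h1 : (MvPowerSeries.X v : MvPowerSeries σ k) ∣ a - 1 := by
    have h : Polynomial.X ∣ p - 1 := by
      rw [Polynomial.X_dvd_iff]; simp [hp]
    simpa [ha] using map_dvd (Polynomial.aeval (MvPowerSeries.X v : MvPowerSeries σ k)) h
  have h2 : a⁻¹ - 1 = (a - 1) * (-a⁻¹) := by
    have := MvPowerSeries.mul_inv_cancel a hc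
    linear_combination this
  exact h2 ▸ Dvd.dvd.mul_right h1 _

theorem multipliable_eulerProd (hf : ∀ q, (f q).coeff 0 = 1) :
    letI : TopologicalSpace k := ⊥
    Multipliable fun v : P × ℕ =>
      (Polynomial.aeval (MvPowerSeries.X v : MvPowerSeries (P × ℕ) k) (f v.1))⁻¹ := by
  let _ : TopologicalSpace k := ⊥
  classical
  set g : P × ℕ → MvPowerSeries (P × ℕ) k := fun v =>
    (Polynomial.aeval (MvPowerSeries.X v : MvPowerSeries (P × ℕ) k) (f v.1))⁻¹ - 1 with hg
  have key : Multipliable (1 + g ·) := by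
    refine multipliable_one_add_of_summable_prod ?_
    refine MvPowerSeries.WithPiTopology.summable_iff_summable_coeff.mpr fun d =>
      summable_of_hasFiniteSupport ?_
    refine (d.support.powerset.finite_toSet).subset fun s hs => ?_
    rw [Finset.mem_coe, Finset.mem_powerset]
    intro v hv
    by_contra hd
    refine hs ?_
    have hdvd : MvPowerSeries.X v ∣ ∏ i ∈ s, g i :=
      (X_dvd_inv_aeval_sub_one (f v.1) (hf v.1) v).trans (Finset.dvd_prod_of_mem g hv)
    exact MvPowerSeries.X_dvd_iff.mp hdvd d (by simpa using hd)
  simpa [hg] using key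

theorem eulerProd_mem (hf : ∀ q, (f q).coeff 0 = 1) : eulerProd f ∈ blockSymmetric P k := by
  let _ : TopologicalSpace k := ⊥
  have : DiscreteTopology k := ⟨rfl⟩
  intro τ
  set e := Equiv.prodCongrRight τ with he
  have hcont : Continuous (MvPowerSeries.renameEquiv k e) := by
    refine continuous_pi fun d => ?_
    have : ∀ F : MvPowerSeries (P × ℕ) k, MvPowerSeries.renameEquiv k e F d =
        MvPowerSeries.coeff (d.embDomain e.symm.toEmbedding) F := by
      intro F
      have h := MvPowerSeries.coeff_embDomain_rename e.toEmbedding F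
        (d.embDomain e.symm.toEmbedding)
      rw [← h]
      have h2 : (d.embDomain e.symm.toEmbedding).embDomain e.toEmbedding = d := by
        simp [Finsupp.embDomain_eq_mapDomain, ← Finsupp.mapDomain_comp]
      rw [h2]
      rfl
    simp_rw [this]
    exact MvPowerSeries.WithPiTopology.continuous_coeff k _
  have hmap := (multipliable_eulerProd hf).map_tprod (MvPowerSeries.renameEquiv k e) hcont
  unfold eulerProd
  refine hmap.trans (Eq.trans (tprod_congr fun v => ?_) (e.tprod_eq _))
  have hv : (e v).1 = v.1 := rfl
  have hc : ∀ w : P × ℕ, MvPowerSeries.constantCoeff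
      (Polynomial.aeval (MvPowerSeries.X w : MvPowerSeries (P × ℕ) k) (f v.1)) ≠ 0 := fun w => by
    rw [constantCoeff_aeval_X, hf]; exact one_ne_zero
  rw [hv, MvPowerSeries.eq_inv_iff_mul_eq_one (hc _)]
  have hX : MvPowerSeries.renameEquiv k e (Polynomial.aeval (MvPowerSeries.X v) (f v.1)) =
      Polynomial.aeval (MvPowerSeries.X (e v)) (f v.1) := by
    rw [← AlgEquiv.coe_toAlgHom, ← Polynomial.aeval_algHom_apply]
    simp
  rw [← hX, ← map_mul, MvPowerSeries.inv_mul_cancel _ (hc v), map_one]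

end Product

/-! ### Artin symmetric functions -/

section Artin

variable {K L : Type*} [Field K] [NumberField K] [Field L] [NumberField L] [Algebra K L]
  [IsGalois K L]

variable (K L) in
/-- The choices entering the definition of an Artin symmetric function for `L/K`: for each nonzero
prime `q` of `K`, a prime `p` of `L` above `q` and a (lift to `Gal(L/K)` of the) Frobenius
element at `p`, i.e. a `σ` with `σ x ≡ x ^ #(𝓞 K / q) mod p` for all `x` in `𝓞 L`. -/
structure FrobeniusChoice where
  prime : HeightOneSpectrum (𝓞 K) → HeightOneSpectrum (𝓞 L)
  under_prime : ∀ q, (prime q).under (𝓞 K) = q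
  frob : HeightOneSpectrum (𝓞 K) → Gal(L/K)
  isArithFrobAt : ∀ q, IsArithFrobAt (𝓞 K) (frob q) (prime q).asIdeal

instance nonempty_frobeniusChoice : Nonempty (FrobeniusChoice K L) := by
  have h : ∀ q : HeightOneSpectrum (𝓞 K), ∃ p : HeightOneSpectrum (𝓞 L), ∃ σ : Gal(L/K),
      p.under (𝓞 K) = q ∧ IsArithFrobAt (𝓞 K) σ p.asIdeal := by
    intro q
    have : q.asIdeal.IsMaximal := q.isMaximal
    obtain ⟨p, hp, hpq⟩ := Ideal.exists_maximal_ideal_liesOver_of_isIntegral (S := 𝓞 L) q.asIdeal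
    have hne : p ≠ ⊥ := Ideal.ne_bot_of_liesOver_of_ne_bot q.ne_bot p
    have : Finite (𝓞 L ⧸ p) := Ideal.finiteQuotientOfFreeOfNeBot p hne
    obtain ⟨σ, hσ⟩ := IsArithFrobAt.exists_of_isInvariant (𝓞 K) Gal(L/K) p
    exact ⟨⟨p, hp.isPrime, hne⟩, σ, HeightOneSpectrum.ext hpq.over.symm, hσ⟩
  choose p σ h1 h2 using h
  exact ⟨⟨p, h1, σ, h2⟩⟩

variable {V : Type*} [AddCommGroup V] [Module ℂ V]

/-- `V^{I(q)}`, where `I(q)` is the inertia group of the chosen prime above `q`. -/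
abbrev inertiaInvariants (c : FrobeniusChoice K L) (ρ : Representation ℂ Gal(L/K) V)
    (q : HeightOneSpectrum (𝓞 K)) : Submodule ℂ V :=
  invariants (ρ.comp ((c.prime q).asIdeal.inertia Gal(L/K)).subtype)

theorem frob_mem_inertiaInvariants (c : FrobeniusChoice K L) (ρ : Representation ℂ Gal(L/K) V)
    (q : HeightOneSpectrum (𝓞 K)) (x : V) (hx : x ∈ inertiaInvariants c ρ q) :
    ρ (c.frob q) x ∈ inertiaInvariants c ρ q := by
  rintro ⟨s, hs⟩
  have hcomap := (c.isArithFrobAt q).comap_eq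
  have hs' : (c.frob q)⁻¹ * s * c.frob q ∈ (c.prime q).asIdeal.inertia Gal(L/K) := by
    intro y
    rw [← hcomap]
    have := hs (c.frob q • y)
    simpa [Ideal.mem_comap, mul_smul, smul_sub] using this
  have := congrArg (ρ (c.frob q)) (hx ⟨_, hs'⟩)
  simpa [← Module.End.mul_apply, ← map_mul, mul_assoc] using this

/-- `ρ(σ_q)` restricted to `V^{I(q)}`. -/
def frobAction (c : FrobeniusChoice K L) (ρ : Representation ℂ Gal(L/K) V)
    (q : HeightOneSpectrum (𝓞 K)) :
    inertiaInvariants c ρ q →ₗ[ℂ] inertiaInvariants c ρ q :=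
  (ρ (c.frob q)).restrict (frob_mem_inertiaInvariants c ρ q)

theorem frobAction_pow (c : FrobeniusChoice K L) (ρ : Representation ℂ Gal(L/K) V)
    (q : HeightOneSpectrum (𝓞 K)) : frobAction c ρ q ^ Nat.card Gal(L/K) = 1 := by
  unfold frobAction
  rw [Module.End.pow_restrict]
  ext x
  simp [LinearMap.restrict_apply, ← map_pow]

variable [FiniteDimensional ℂ V]

/-- `det(1 - x ρ(σ_q) | V^{I(q)})` as a polynomial in `x` over `ℂ`. -/
def localFactor (c : FrobeniusChoice K L) (ρ : Representation ℂ Gal(L/K) V)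
    (q : HeightOneSpectrum (𝓞 K)) : ℂ[X] :=
  (LinearMap.toMatrix (Module.finBasis ℂ (inertiaInvariants c ρ q))
    (Module.finBasis ℂ (inertiaInvariants c ρ q)) (frobAction c ρ q)).charpolyRev

/-- The local factors have coefficients in `ℚ^ab`. -/
theorem exists_localFactor_lift (c : FrobeniusChoice K L) (ρ : Representation ℂ Gal(L/K) V)
    (q : HeightOneSpectrum (𝓞 K)) :
    ∃ p : QAb[X], p.map (algebraMap QAb ℂ) = localFactor c ρ q := by
  set T := frobAction c ρ q
  set χ := T.charpoly with hχ
  have hroots : ∀ z ∈ χ.roots, z ∈ QAb := by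
    intro z hz
    have hev : Module.End.HasEigenvalue T z := by
      rw [Module.End.hasEigenvalue_iff_isRoot_charpoly]
      exact Polynomial.isRoot_of_mem_roots hz
    obtain ⟨v, hv⟩ := hev.exists_hasEigenvector
    have hpow := hv.pow_apply (Nat.card Gal(L/K))
    rw [frobAction_pow, Module.End.one_apply] at hpow
    refine mem_QAb_of_pow_eq_one (n := Nat.card Gal(L/K)) Nat.card_pos ?_
    have h0 : (z ^ Nat.card Gal(L/K) - 1) • v = 0 := by
      rw [sub_smul, one_smul, ← hpow, sub_self]
    rcases smul_eq_zero.mp h0 with h | h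
    · exact sub_eq_zero.mp h
    · exact absurd h hv.2
  have hlift : χ ∈ Polynomial.lifts (algebraMap QAb ℂ) := by
    have hsplit := (IsAlgClosed.splits χ).eq_prod_roots_of_monic T.charpoly_monic
    rw [hsplit]
    refine Subsemiring.multiset_prod_mem _ _ fun p hp => ?_
    obtain ⟨z, hz, rfl⟩ := Multiset.mem_map.mp hp
    exact ⟨Polynomial.X - Polynomial.C ⟨z, hroots z hz⟩, by simp⟩
  obtain ⟨p, hp⟩ := hlift
  refine ⟨p.reverse, ?_⟩
  have hrev : (p.map (algebraMap QAb ℂ)).reverse = p.reverse.map (algebraMap QAb ℂ) := by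
    unfold Polynomial.reverse
    rw [Polynomial.reflect_map, Polynomial.natDegree_map]
  rw [← hrev]
  change (Polynomial.mapRingHom (algebraMap QAb ℂ) p).reverse = _
  have hp' : Polynomial.mapRingHom (algebraMap QAb ℂ) p = χ := hp
  rw [hp', localFactor, ← Matrix.reverse_charpoly, LinearMap.charpoly_toMatrix]

/-- The local factor `f_q(x, ρ; L/K) = det(1 - x ρ(σ_q) | V^{I(q)})` as a polynomial over
`ℚ^ab ⊆ ℂ`. -/
def localPoly (c : FrobeniusChoice K L) (ρ : Representation ℂ Gal(L/K) V)
    (q : HeightOneSpectrum (𝓞 K)) : QAb[X] :=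
  (exists_localFactor_lift c ρ q).choose

theorem map_localPoly (c : FrobeniusChoice K L) (ρ : Representation ℂ Gal(L/K) V)
    (q : HeightOneSpectrum (𝓞 K)) :
    (localPoly c ρ q).map (algebraMap QAb ℂ) = localFactor c ρ q :=
  (exists_localFactor_lift c ρ q).choose_spec

theorem coeff_zero_localPoly (c : FrobeniusChoice K L) (ρ : Representation ℂ Gal(L/K) V)
    (q : HeightOneSpectrum (𝓞 K)) : (localPoly c ρ q).coeff 0 = 1 := by
  apply (algebraMap QAb ℂ).injective
  rw [← Polynomial.coeff_map, map_localPoly, Polynomial.coeff_zero_eq_eval_zero, localFactor,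
    Matrix.eval_charpolyRev, map_one]

/-- The Artin symmetric function
`𝓛(X_K, ρ; L/K) = ∏ q, ∏ i, det(1 - x_i^{(q)} ρ(σ_q) | V^{I(q)})⁻¹ ∈ 𝒜_K`. -/
def artinSym (c : FrobeniusChoice K L) (ρ : Representation ℂ Gal(L/K) V) : ArithRing K :=
  ⟨eulerProd (localPoly c ρ), eulerProd_mem (coeff_zero_localPoly c ρ)⟩

end Artin

/-- Representations induced to a finite group are finite dimensional. -/
instance finiteDimensional_indV {G H V : Type*} [Group G] [Group H] [Finite H] (φ : G →* H)
    [AddCommGroup V] [Module ℂ V] [FiniteDimensional ℂ V] (ρ : Representation ℂ G V) :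
    FiniteDimensional ℂ (IndV φ ρ) := by
  have : Module.Finite ℂ (MonoidAlgebra ℂ H) := inferInstance
  exact Module.Finite.of_surjective (Coinvariants.mk _) (Coinvariants.mk_surjective _)

section Tower

variable (K L E : Type*) [Field K] [Field L] [Field E] [Algebra K L] [Algebra L E] [Algebra K E]
  [IsScalarTower K L E]

/-- The inflation of a representation of `Gal(L/K)` along the restriction map
`Gal(E/K) → Gal(L/K)`. -/
def inflation [Normal K L] {V : Type*} [AddCommGroup V] [Module ℂ V]
    (ρ : Representation ℂ Gal(L/K) V) : Representation ℂ Gal(E/K) V :=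
  ρ.comp (AlgEquiv.restrictNormalHom L)

/-- The representation of `Gal(E/K)` induced from a representation of its subgroup `Gal(E/L)`. -/
def induction {V : Type*} [AddCommGroup V] [Module ℂ V]
    (ρ : Representation ℂ Gal(E/L) V) :
    Representation ℂ Gal(E/K) (IndV (AlgEquiv.restrictScalarsHom K : Gal(E/L) →* Gal(E/K)) ρ) :=
  ind (AlgEquiv.restrictScalarsHom K : Gal(E/L) →* Gal(E/K)) ρ

end Tower

end ArithSym

end

/-!
The three identities hold factor by factor, prime by prime, and the local factors are compared
through the traces of powers of Frobenius.

A polynomial `F` with constant term `1` over a field of characteristic zero is determined by the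
sequence `a` with `-X F' / F = ∑ n ≥ 1, a n X ^ n` (`HasPowerSums.unique`). For
`F = det(1 - X T)` this sequence is `a n = tr (T ^ n)`, by Jacobi's formula for the derivative of a
determinant (`hasPowerSums_charpolyRev`). For the local factor of `ρ` at `q`, projecting onto the
inertia invariants shows that `a n` is the mean `powerMean` of the character of `ρ` over the set
`powerSet` of those elements of the Galois group that act on the residue field of a prime `P` above
`q` as `x ↦ x ^ (N q ^ n)` (`hasPowerSums_localFactor`). This mean involves neither the Frobenius
element nor, up to conjugation, the prime `P`, so the local factors do not depend on the choices.

* For a direct sum, characters and hence means add up.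
* For an inflation, restriction maps the inertia group of `P` onto that of the prime below `P`
  (`inertiaRestrict_surjective`, by counting: ramification indices are multiplicative in towers),
  so restriction preserves means (`powerMean_comp_restrictNormalHom`).
* For an induced representation, summing the formula for the induced character (`character_ind`)
  over `powerSet` gives a sum, over the conjugates `t • P`, of means for `Gal(E/L)`. Each prime of
  `L` above `q` lies below equally many of these conjugates, and the mean is
  `f ∑ p, powerMean (T p) _ _`, summed over the primes `p` of `L` above `q`
  (`powerMean_induction`). The means on the right vanish unless the residue degree `f` divides `n`
  (`inertiaDeg_dvd_of_mem_powerSet`). This is the power sum sequence of the product over `p` of the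
  local factors at `p` evaluated at `X ^ f` (`HasPowerSums.expand`).

The norm map sends an Euler product over the primes of `L` to the Euler product over the primes of
`K` obtained by collecting the factors at the primes above each `q` (`subst_eulerProd`), since
substitution is continuous for the topology of coefficientwise convergence.
-/

noncomputable section

namespace ArithSym

/-! ### Polynomials determined by a sequence of power sums -/

theorem derivation_prod {R A n : Type*} [CommRing R] [CommRing A] [Algebra R A] [DecidableEq n]
    (D : Derivation R A A) (s : Finset n) (f : n → A) :
    D (∏ i ∈ s, f i) = ∑ j ∈ s, (∏ i ∈ s.erase j, f i) * D (f j) := by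
  induction s using Finset.induction_on with
  | empty => simp
  | insert i s hi ih =>
    rw [Finset.prod_insert hi, Derivation.leibniz, ih, Finset.sum_insert hi,
      Finset.erase_insert hi, smul_eq_mul, smul_eq_mul, add_comm, Finset.mul_sum]
    congr 1
    refine Finset.sum_congr rfl fun j hj => ?_
    have hij : i ≠ j := fun h => hi (h ▸ hj)
    rw [Finset.erase_insert_of_ne hij, Finset.prod_insert (fun h => hi (Finset.mem_of_mem_erase h)),
      mul_assoc]

/-- Jacobi's formula for the derivative of a determinant, for an arbitrary derivation. -/
theorem derivation_det {R A n : Type*} [CommRing R] [CommRing A] [Algebra R A] [Fintype n]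
    [DecidableEq n] (D : Derivation R A A) (M : Matrix n n A) :
    D M.det = (M.adjugate * M.map D).trace := by
  -- differentiate one column at a time; the summands are then entries of `adj M * D M` by Cramer
  have h : D M.det = ∑ j, (M.updateCol j fun i => D (M i j)).det := by
    simp only [Matrix.det_apply, map_sum]
    rw [Finset.sum_comm]
    refine Finset.sum_congr rfl fun σ _ => ?_
    rw [Units.smul_def, map_zsmul, derivation_prod, Finset.smul_sum]
    refine Finset.sum_congr rfl fun j _ => ?_
    rw [Units.smul_def, ← Finset.mul_prod_erase _ _ (Finset.mem_univ j),
      Matrix.updateCol_self, mul_comm]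
    congr 2
    refine Finset.prod_congr rfl fun i hi => ?_
    rw [Matrix.updateCol_ne (Finset.ne_of_mem_erase hi)]
  rw [h, Matrix.trace]
  refine Finset.sum_congr rfl fun j _ => ?_
  rw [← Matrix.cramer_apply, Matrix.cramer_eq_adjugate_mulVec]
  rfl

open PowerSeries in
/-- `F' = -F ∑ n, a (n + 1) X ^ n`, i.e. `-X F' / F = ∑ n ≥ 1, a n X ^ n`. For
`F = det(1 - X T)` this holds with `a n = tr (T ^ n)`. -/
def HasPowerSums {k : Type*} [CommRing k] (F : k[X]) (a : ℕ → k) : Prop :=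
  d⁄dX k (F : PowerSeries k) = -(F : PowerSeries k) * PowerSeries.mk fun n => a (n + 1)

/-- Jacobi's formula for `det(1 - X T)`, where `adj(1 - X T) = det(1 - X T) ∑ m, X ^ m T ^ m`. -/
theorem hasPowerSums_charpolyRev {k n : Type*} [CommRing k] [Fintype n] [DecidableEq n]
    (T : Matrix n n k) : HasPowerSums T.charpolyRev fun m => (T ^ m).trace := by
  set A : Matrix n n (PowerSeries k) := 1 - (PowerSeries.X : PowerSeries k) • T.map PowerSeries.C
    with hA
  -- `G = ∑ m, X ^ m T ^ m` is the inverse of `A = 1 - X T`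
  set G : Matrix n n (PowerSeries k) := Matrix.of fun i j => PowerSeries.mk fun m => (T ^ m) i j
    with hG
  have hdet : (T.charpolyRev : PowerSeries k) = A.det := by
    change Polynomial.coeToPowerSeries.ringHom T.charpolyRev = _
    rw [Matrix.charpolyRev, RingHom.map_det, hA]
    congr 1
    ext i j : 1
    by_cases h : i = j <;> simp [h, mul_comm PowerSeries.X]
  have hAG : A * G = 1 := by
    rw [hA, sub_mul, one_mul, Matrix.smul_mul]
    ext i j m
    rw [Matrix.sub_apply, Matrix.smul_apply, map_sub, smul_eq_mul]
    cases m with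
    | zero => simp [hG, Matrix.one_apply]
    | succ m =>
      rw [PowerSeries.coeff_succ_X_mul]
      have h0 : PowerSeries.coeff (m + 1) ((1 : Matrix n n (PowerSeries k)) i j) = 0 := by
        by_cases h : i = j <;> simp [h, Matrix.one_apply, PowerSeries.coeff_one]
      rw [h0]
      simp [hG, Matrix.mul_apply, pow_succ']
  have hadj : A.adjugate = A.det • G := by
    have h := congrArg (A.adjugate * ·) hAG
    simp only [← mul_assoc, Matrix.adjugate_mul, mul_one] at h
    rw [← h, Matrix.smul_mul, one_mul]
  have hD : A.map (PowerSeries.derivative k) = -T.map PowerSeries.C := by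
    ext i j : 1
    have h0 : PowerSeries.derivative k ((1 : Matrix n n (PowerSeries k)) i j) = 0 := by
      by_cases h : i = j <;> simp [h, Matrix.one_apply]
    simp [hA, h0]
  unfold HasPowerSums
  rw [hdet, derivation_det, hadj, hD, Matrix.smul_mul, Matrix.trace_smul, smul_eq_mul, neg_mul,
    Matrix.mul_neg, Matrix.trace_neg, mul_neg]
  congr 2
  ext m
  simp [hG, Matrix.trace, Matrix.mul_apply, pow_succ]

namespace HasPowerSums

variable {k : Type*} [Field k]

theorem mul {F G : k[X]} {a b : ℕ → k} (hF : HasPowerSums F a) (hG : HasPowerSums G b) :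
    HasPowerSums (F * G) fun n => a n + b n := by
  unfold HasPowerSums at *
  have h : (PowerSeries.mk fun n => a (n + 1) + b (n + 1)) =
      (PowerSeries.mk fun n => a (n + 1)) + PowerSeries.mk fun n => b (n + 1) := by
    ext; simp
  rw [Polynomial.coe_mul, Derivation.leibniz, hF, hG, h, smul_eq_mul, smul_eq_mul]
  ring

theorem prod {ι : Type*} (s : Finset ι) {F : ι → k[X]} {a : ι → ℕ → k}
    (h : ∀ i ∈ s, HasPowerSums (F i) (a i)) :
    HasPowerSums (∏ i ∈ s, F i) fun n => ∑ i ∈ s, a i n := by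
  classical
  induction s using Finset.induction_on with
  | empty =>
    have : PowerSeries.mk (fun _ : ℕ => (0 : k)) = 0 := by ext; simp
    simp [HasPowerSums, this]
  | insert i s hi ih =>
    simp only [Finset.prod_insert hi, Finset.sum_insert hi]
    exact (h i (Finset.mem_insert_self i s)).mul
      (ih fun j hj => h j (Finset.mem_insert_of_mem hj))

/-- Replacing `X` by `X ^ f` multiplies the power sums by `f` and spreads them out to the
multiples of `f`. -/
theorem expand {F : k[X]} {a : ℕ → k} (hF : HasPowerSums F a) {f : ℕ} (hf : f ≠ 0) :
    HasPowerSums (Polynomial.expand k f F) fun n => if f ∣ n then f * a (n / f) else 0 := by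
  have hcoe : ∀ p : k[X], ((Polynomial.expand k f p : k[X]) : PowerSeries k) =
      PowerSeries.expand f hf (p : PowerSeries k) := by
    intro p
    ext m
    rw [Polynomial.coeff_coe, Polynomial.coeff_expand (Nat.pos_of_ne_zero hf),
      PowerSeries.coeff_expand]
    simp
  unfold HasPowerSums at *
  rw [PowerSeries.derivative_coe, Polynomial.derivative_expand] at *
  rw [Polynomial.coe_mul, hcoe, hcoe, hF, map_mul, map_neg, mul_assoc]
  congr 1
  ext m
  have h1 : (((f : k[X]) * Polynomial.X ^ (f - 1) : k[X]) : PowerSeries k) =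
      PowerSeries.C (f : k) * PowerSeries.X ^ (f - 1) := by
    rw [← Polynomial.C_eq_natCast, Polynomial.coe_mul, Polynomial.coe_C, Polynomial.coe_pow,
      Polynomial.coe_X]
  rw [h1, mul_comm, mul_assoc, PowerSeries.coeff_C_mul, PowerSeries.coeff_X_pow_mul',
    PowerSeries.coeff_mk, PowerSeries.coeff_expand]
  obtain ⟨f, rfl⟩ := Nat.exists_eq_succ_of_ne_zero hf
  -- writing `f + 1` for the exponent, the chain rule contributes a factor `X ^ f`, and `m - f` is
  -- divisible by `f + 1` exactly when `m + 1` is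
  have hiff : f.succ ∣ m + 1 ↔ f ≤ m ∧ f.succ ∣ m - f := by
    constructor
    · intro h
      have hle : f.succ ≤ m + 1 := Nat.le_of_dvd (Nat.succ_pos m) h
      refine ⟨by omega, ?_⟩
      have := Nat.dvd_sub h (dvd_refl f.succ)
      rwa [Nat.succ_eq_add_one, Nat.add_sub_add_right] at this
    · rintro ⟨hle, h⟩
      have := Nat.dvd_add h (dvd_refl f.succ)
      rwa [show m - f + f.succ = m + 1 by omega] at this
  rw [Nat.succ_sub_one]
  by_cases h : f.succ ∣ m + 1
  · obtain ⟨hle, hd⟩ := hiff.mp h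
    have hq : (m + 1) / f.succ = (m - f) / f.succ + 1 := by
      rw [← Nat.add_div_right _ (Nat.succ_pos f)]
      congr 1
      omega
    simp [h, hle, hd, hq]
  · change _ = if f.succ ∣ m + 1 then _ else _
    rw [if_neg h]
    by_cases hle : f ≤ m
    · have hd : ¬ f.succ ∣ m - f := fun hd => h (hiff.mpr ⟨hle, hd⟩)
      simp [hle, hd]
    · simp [hle]

/-- In characteristic zero a polynomial with constant term `1` is determined by its power sums. -/
theorem unique [CharZero k] {F G : k[X]} {a : ℕ → k} (hF : HasPowerSums F a)
    (hG : HasPowerSums G a) (hF0 : F.coeff 0 = 1) (hG0 : G.coeff 0 = 1) : F = G := by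
  unfold HasPowerSums at *
  have hcF : PowerSeries.constantCoeff (F : PowerSeries k) = 1 := by simpa using hF0
  have hcG : PowerSeries.constantCoeff (G : PowerSeries k) = 1 := by simpa using hG0
  have hne : PowerSeries.constantCoeff (G : PowerSeries k) ≠ 0 := by simp [hcG]
  have hinv := PowerSeries.inv_mul_cancel _ hne
  -- the logarithmic derivatives agree, so the quotient has derivative zero
  have hquot : (F : PowerSeries k) * (G : PowerSeries k)⁻¹ = 1 := by
    refine PowerSeries.derivative.ext ?_ (by simp [hcF, hcG])
    rw [Derivation.leibniz, PowerSeries.derivative_inv', hF, hG, PowerSeries.derivative_one,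
      smul_eq_mul, smul_eq_mul]
    linear_combination (F : PowerSeries k) * (G : PowerSeries k)⁻¹ *
      (PowerSeries.mk fun n => a (n + 1)) * hinv
  have : (F : PowerSeries k) = G := by
    linear_combination (G : PowerSeries k) * hquot - (F : PowerSeries k) * hinv
  exact_mod_cast this

end HasPowerSums

/-! ### Traces on invariants, on coinvariants and on induced representations -/

section Traces

theorem inv_card_smul_sum_const {k G : Type*} [Field k] [CharZero k] [Fintype G] [Nonempty G]
    {W : Type*} [AddCommGroup W] [Module k W] (w : W) :
    (Nat.card G : k)⁻¹ • ∑ _g : G, w = w := by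
  have : (Nat.card G : k) ≠ 0 := Nat.cast_ne_zero.mpr Nat.card_pos.ne'
  rw [Finset.sum_const, Finset.card_univ, ← Nat.card_eq_fintype_card, ← Nat.cast_smul_eq_nsmul k,
    smul_smul, inv_mul_cancel₀ this, one_smul]

theorem sum_coe_eq_sum_indicator {G : Type*} [Fintype G] {M : Type*} [AddCommMonoid M]
    (S : Set G) [Fintype S] (F : G → M) : ∑ s : S, F s = ∑ g, S.indicator F g := by
  rw [← finsum_eq_sum_of_fintype, ← finsum_eq_sum_of_fintype, finsum_set_coe_eq_finsum_mem,
    finsum_mem_def]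

variable {k G V : Type*} [Field k] [Group G] [Fintype G] [AddCommGroup V] [Module k V]

/-- The average `|G|⁻¹ ∑ g, ρ g`, which in characteristic zero is the projection onto the
invariants. -/
def avg (ρ : Representation k G V) : V →ₗ[k] V := (Nat.card G : k)⁻¹ • ∑ g, ρ g

theorem avg_comp (ρ : Representation k G V) (g : G) : avg ρ ∘ₗ ρ g = avg ρ := by
  unfold avg
  rw [LinearMap.smul_comp, ← Module.End.mul_eq_comp, Finset.sum_mul]
  congr 1
  simp_rw [← map_mul]
  exact Equiv.sum_comp (Equiv.mulRight g) fun x => ρ x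

theorem comp_avg (ρ : Representation k G V) (g : G) : ρ g ∘ₗ avg ρ = avg ρ := by
  unfold avg
  rw [LinearMap.comp_smul, ← Module.End.mul_eq_comp, Finset.mul_sum]
  congr 1
  simp_rw [← map_mul]
  exact Equiv.sum_comp (Equiv.mulLeft g) fun x => ρ x

theorem trace_comp_avg (ρ : Representation k G V) (T : V →ₗ[k] V) :
    LinearMap.trace k V (T ∘ₗ avg ρ) =
      (Nat.card G : k)⁻¹ * ∑ g, LinearMap.trace k V (T ∘ₗ ρ g) := by
  unfold avg
  rw [LinearMap.comp_smul, ← Module.End.mul_eq_comp, Finset.mul_sum, map_smul, map_sum, smul_eq_mul]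
  rfl

variable [CharZero k] [FiniteDimensional k V]

/-- The restriction of `T` factors as `π ∘ T ∘ ι`, with `ι` the inclusion of the invariants and `π`
the averaging projection, and `ι ∘ π` is the average on `V`. -/
theorem trace_restrict_invariants (ρ : Representation k G V) (T : V →ₗ[k] V)
    (hT : ∀ x ∈ invariants ρ, T x ∈ invariants ρ) :
    LinearMap.trace k (invariants ρ) (T.restrict hT) =
      (Nat.card G : k)⁻¹ * ∑ g, LinearMap.trace k V (T ∘ₗ ρ g) := by
  let π : V →ₗ[k] invariants ρ :=
    (avg ρ).codRestrict _ fun v g => LinearMap.congr_fun (comp_avg ρ g) v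
  have h : T.restrict hT = π ∘ₗ (T ∘ₗ (invariants ρ).subtype) := by
    ext x
    have hx := hT x x.2
    have : avg ρ (T x) = T x := by
      simp only [avg, LinearMap.smul_apply, LinearMap.sum_apply, hx _]
      exact inv_card_smul_sum_const _
    exact this.symm
  rw [h, LinearMap.trace_comp_comm', ← trace_comp_avg]
  rfl

/-- The average induces a section `s` of the projection `mk` onto the coinvariants, so `T'` factors
as `mk ∘ T ∘ s`, and `s ∘ mk` is the average on `V`. -/
theorem trace_coinvariants (ρ : Representation k G V) (T : V →ₗ[k] V)
    (T' : Coinvariants ρ →ₗ[k] Coinvariants ρ)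
    (hT : T' ∘ₗ Coinvariants.mk ρ = Coinvariants.mk ρ ∘ₗ T) :
    LinearMap.trace k (Coinvariants ρ) T' =
      (Nat.card G : k)⁻¹ * ∑ g, LinearMap.trace k V (T ∘ₗ ρ g) := by
  let s : Coinvariants ρ →ₗ[k] V := Coinvariants.lift ρ (avg ρ) (avg_comp ρ)
  have hs : Coinvariants.mk ρ ∘ₗ s = LinearMap.id := by
    refine Coinvariants.hom_ext ?_
    ext v
    have hg : ∀ g, Coinvariants.mk ρ (ρ g v) = Coinvariants.mk ρ v := fun g =>
      (Coinvariants.mk_eq_iff ρ).2 (Coinvariants.sub_mem_ker g v)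
    simp only [s, LinearMap.comp_apply, Coinvariants.lift_mk, avg, LinearMap.smul_apply,
      LinearMap.sum_apply, map_smul, map_sum, hg]
    exact inv_card_smul_sum_const _
  have h : T' = (Coinvariants.mk ρ ∘ₗ T) ∘ₗ s := by
    rw [← hT, LinearMap.comp_assoc, hs, LinearMap.comp_id]
  rw [h, LinearMap.comp_assoc, LinearMap.trace_comp_comm', ← trace_comp_avg]
  rfl

theorem trace_invariantsSubgroup (ρ : Representation k G V) (I : Subgroup G) (T : G)
    (hT : ∀ x ∈ invariants (ρ.comp I.subtype), ρ T x ∈ invariants (ρ.comp I.subtype)) (n : ℕ) :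
    LinearMap.trace k _ (((ρ T).restrict hT) ^ n) =
      (Nat.card I : k)⁻¹ * ∑ g, (I : Set G).indicator (fun s => ρ.character (s * T ^ n)) g := by
  classical
  rw [Module.End.pow_restrict, trace_restrict_invariants]
  congr 1
  rw [← sum_coe_eq_sum_indicator]
  refine Finset.sum_congr rfl fun s _ => ?_
  rw [Representation.character, map_mul, map_pow, LinearMap.trace_mul_comm]
  rfl

end Traces

theorem trace_mapDomainLinearMap {k H : Type*} [Field k] [Fintype H] [DecidableEq H] (σ : H → H) :
    LinearMap.trace k (MonoidAlgebra k H) (MonoidAlgebra.mapDomainLinearMap k k σ) =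
      ∑ t, if σ t = t then 1 else 0 := by
  rw [LinearMap.trace_eq_matrix_trace k (MonoidAlgebra.basis H k), Matrix.trace]
  refine Finset.sum_congr rfl fun t _ => ?_
  simp [LinearMap.toMatrix_apply, MonoidAlgebra.basis, Finsupp.single_apply]

/-- The character of an induced representation, as a sum over all of both groups. It is the average
of traces on `k[H] ⊗ V`, where the trace on `k[H]` of `y ↦ φ g * y * x⁻¹` counts fixed points. -/
theorem character_ind {k G H V : Type*} [Field k] [CharZero k] [Group G] [Fintype G] [Group H]
    [Fintype H] [DecidableEq H] (φ : G →* H) [AddCommGroup V] [Module k V] [FiniteDimensional k V]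
    (ρ : Representation k G V) (x : H) :
    (ind φ ρ).character x =
      (Nat.card G : k)⁻¹ * ∑ g, ∑ t, if t⁻¹ * φ g * t = x then ρ.character g else 0 := by
  rw [Representation.character, trace_coinvariants _
    ((MonoidAlgebra.mapDomainLinearMap k k fun y => y * x⁻¹).rTensor V) _ rfl]
  congr 1
  refine Finset.sum_congr rfl fun g _ => ?_
  have h : LinearMap.rTensor V (MonoidAlgebra.mapDomainLinearMap k k fun y => y * x⁻¹) ∘ₗ
      (Representation.tprod ((leftRegular k H).comp φ) ρ) g =
      TensorProduct.map (MonoidAlgebra.mapDomainLinearMap k k fun y => φ g * y * x⁻¹) (ρ g) := by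
    ext y v
    simp [ofMulAction_single]
  rw [h, LinearMap.trace_tensorProduct', trace_mapDomainLinearMap, Finset.sum_mul]
  refine Finset.sum_congr rfl fun t _ => ?_
  have : φ g * t * x⁻¹ = t ↔ t⁻¹ * φ g * t = x := by
    rw [mul_inv_eq_iff_eq_mul, mul_assoc, inv_mul_eq_iff_eq_mul]
  -- `t` is a fixed point of `y ↦ φ g * y * x⁻¹` exactly when `t⁻¹ * φ g * t = x`
  simp only [this, ite_mul, one_mul, zero_mul]
  rfl

/-! ### Means over the elements that act as a given power map modulo a prime -/

section PowerMap

open scoped Pointwise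

variable {G S : Type*} [Group G] [CommRing S] [MulSemiringAction G S]

variable (G) in
/-- The elements of `G` that act on `S / P` as `x ↦ x ^ N`. For `N = 1` this is the inertia group
of `P`; for `N` the `n`-th power of the cardinality of the residue field below, it is the coset of
the `n`-th powers of the Frobenius elements at `P`. -/
def powerSet (P : Ideal S) (N : ℕ) : Set G := {g | ∀ x : S, g • x - x ^ N ∈ P}

theorem powerSet_one (P : Ideal S) : powerSet G P 1 = P.inertia G := by
  ext g
  simp only [powerSet, pow_one]
  rfl

theorem mul_mem_powerSet {P : Ideal S} {M N : ℕ} {g h : G} (hg : g ∈ powerSet G P M)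
    (hh : h ∈ powerSet G P N) : g * h ∈ powerSet G P (N * M) := by
  intro x
  have h1 := hg (h • x)
  have h2 : (h • x) ^ M - (x ^ N) ^ M ∈ P := P.mem_of_dvd (sub_dvd_pow_sub_pow _ _ M) (hh x)
  simpa [mul_smul, pow_mul] using P.add_mem h1 h2

theorem pow_mem_powerSet {P : Ideal S} {N : ℕ} {g : G} (hg : g ∈ powerSet G P N) (n : ℕ) :
    g ^ n ∈ powerSet G P (N ^ n) := by
  induction n with
  | zero => intro x; simp
  | succ n ih => rw [pow_succ, pow_succ, mul_comm]; exact mul_mem_powerSet ih hg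

/-- A nonempty `powerSet` is a right coset of the inertia group. -/
theorem mul_mem_powerSet_iff {P : Ideal S} {N : ℕ} {g σ : G} (hσ : σ ∈ powerSet G P N) :
    g * σ ∈ powerSet G P N ↔ g ∈ P.inertia G := by
  refine ⟨fun h x => ?_, fun h => ?_⟩
  · have h1 := h (σ⁻¹ • x)
    have h2 := hσ (σ⁻¹ • x)
    rw [mul_smul, smul_inv_smul] at *
    simpa using P.sub_mem h1 h2
  · have h1 : g ∈ powerSet G P 1 := by rwa [powerSet_one]
    simpa using mul_mem_powerSet h1 hσ

theorem mem_powerSet_smul_iff {P : Ideal S} {N : ℕ} {g t : G} :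
    g ∈ powerSet G (t • P) N ↔ t⁻¹ * g * t ∈ powerSet G P N := by
  have h : ∀ x : S, g • t • x - (t • x) ^ N ∈ t • P ↔ (t⁻¹ * g * t) • x - x ^ N ∈ P := by
    intro x
    rw [Ideal.mem_pointwise_smul_iff_inv_smul_mem]
    simp [mul_smul, smul_sub]
  refine ⟨fun hg x => (h x).mp (hg _), fun hg x => ?_⟩
  simpa using (h (t⁻¹ • x)).mpr (hg _)

theorem card_inertia_smul (P : Ideal S) (t : G) :
    Nat.card ((t • P).inertia G) = Nat.card (P.inertia G) := by
  change Nat.card ((t • P).inertia G : Set G) = Nat.card (P.inertia G : Set G)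
  rw [← powerSet_one, ← powerSet_one]
  refine Nat.card_congr ((MulAut.conj t⁻¹).toEquiv.subtypeEquiv fun g => ?_)
  rw [mem_powerSet_smul_iff]
  simp

variable [Fintype G]

/-- The sum of `χ` over the elements of `G` that act on `S / P` as `x ↦ x ^ N`, divided by the
order of the inertia group. It is the mean of `χ` over these elements if there are any, and zero
otherwise. -/
def powerMean (P : Ideal S) (N : ℕ) (χ : G → ℂ) : ℂ :=
  (Nat.card (P.inertia G) : ℂ)⁻¹ * ∑ g, (powerSet G P N).indicator χ g

theorem powerMean_add (P : Ideal S) (N : ℕ) (χ ψ : G → ℂ) :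
    powerMean P N (χ + ψ) = powerMean P N χ + powerMean P N ψ := by
  simp only [powerMean, Set.indicator_add', Pi.add_apply, Finset.sum_add_distrib, mul_add]

theorem powerMean_eq_sum_inertia {P : Ideal S} {N : ℕ} {σ : G} (hσ : σ ∈ powerSet G P N)
    (χ : G → ℂ) : powerMean P N χ = (Nat.card (P.inertia G) : ℂ)⁻¹ *
      ∑ g, (P.inertia G : Set G).indicator (fun s => χ (s * σ)) g := by
  unfold powerMean
  congr 1
  rw [← Equiv.sum_comp (Equiv.mulRight σ)]
  refine Finset.sum_congr rfl fun g _ => ?_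
  classical
  simp only [Set.indicator_apply, Equiv.coe_mulRight, mul_mem_powerSet_iff hσ]
  rfl

theorem powerMean_smul (P : Ideal S) (N : ℕ) (t : G) (χ : G → ℂ)
    (hχ : ∀ g h, χ (h * g * h⁻¹) = χ g) : powerMean (t • P) N χ = powerMean P N χ := by
  unfold powerMean
  rw [card_inertia_smul]
  congr 1
  rw [← Equiv.sum_comp (MulAut.conj t).toEquiv]
  refine Finset.sum_congr rfl fun g _ => ?_
  classical
  simp only [Set.indicator_apply, mem_powerSet_smul_iff]
  simp only [MulEquiv.toEquiv_eq_coe, EquivLike.coe_coe, MulAut.conj_apply, hχ]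
  simp [mul_assoc]

end PowerMap

/-- The values of a function on the target of a surjective homomorphism of finite groups are all
taken equally often. -/
theorem sum_comp_surjective {G H : Type*} [Group G] [Group H] [Fintype G] [Fintype H] (φ : G →* H)
    (hφ : Function.Surjective φ) (F : H → ℂ) :
    ∑ g, F (φ g) = (Nat.card G / Nat.card H : ℂ) * ∑ h, F h := by
  classical
  have hfib : ∀ h, (Finset.univ.filter fun g => φ g = h).card =
      (Finset.univ.filter fun g => φ g = 1).card := fun h =>
    MonoidHom.card_fiber_eq_of_mem_range φ (hφ h) (hφ 1)
  have hsum : ∀ F : H → ℂ, ∑ g, F (φ g) =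
      ((Finset.univ.filter fun g => φ g = 1).card : ℂ) * ∑ h, F h := by
    intro F
    rw [← Finset.sum_fiberwise Finset.univ φ, Finset.mul_sum]
    refine Finset.sum_congr rfl fun h _ => ?_
    rw [Finset.sum_congr rfl (g := fun _ => F h)
      (fun g hg => by rw [(Finset.mem_filter.mp hg).2]), Finset.sum_const, hfib, nsmul_eq_mul]
  have h1 := hsum fun _ => 1
  have h0 : (Nat.card H : ℂ) ≠ 0 := Nat.cast_ne_zero.mpr Nat.card_pos.ne'
  simp only [Finset.sum_const, Finset.card_univ, nsmul_eq_mul, mul_one,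
    ← Nat.card_eq_fintype_card] at h1
  rw [hsum, h1, mul_div_cancel_right₀ _ h0]

/-! ### Local factors in terms of characters -/

section LocalFactor

variable {K L : Type*} [Field K] [NumberField K] [Field L] [NumberField L] [Algebra K L]
  [IsGalois K L]

theorem liesOver_of_under_eq {K L : Type*} [Field K] [Field L] [NumberField L] [Algebra K L]
    {P : HeightOneSpectrum (𝓞 L)} {q : HeightOneSpectrum (𝓞 K)}
    (h : P.under (𝓞 K) = q)  :
    P.asIdeal.LiesOver q.asIdeal := h ▸ ⟨rfl⟩

theorem frob_mem_powerSet (c : FrobeniusChoice K L) (q : HeightOneSpectrum (𝓞 K)) :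
    c.frob q ∈ powerSet Gal(L/K) (c.prime q).asIdeal (Nat.card (𝓞 K ⧸ q.asIdeal)) := by
  have h := c.isArithFrobAt q
  have hq : (c.prime q).asIdeal.under (𝓞 K) = q.asIdeal :=
    congrArg HeightOneSpectrum.asIdeal (c.under_prime q)
  intro x
  have := h x
  rwa [hq] at this

open scoped Pointwise in
theorem powerMean_eq_of_under_eq {P P' : HeightOneSpectrum (𝓞 L)}
    (h : P.under (𝓞 K) = P'.under (𝓞 K)) (N : ℕ) (χ : Gal(L/K) → ℂ)
    (hχ : ∀ g h, χ (h * g * h⁻¹) = χ g) :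
    powerMean P.asIdeal N χ = powerMean P'.asIdeal N χ := by
  have := liesOver_of_under_eq h
  have := liesOver_of_under_eq (K := K) (P := P') rfl
  obtain ⟨t, ht⟩ := Ideal.exists_smul_eq_of_isGaloisGroup (P'.under (𝓞 K)).asIdeal P'.asIdeal
    P.asIdeal Gal(L/K)
  rw [← ht, powerMean_smul _ _ _ _ hχ]

variable {V : Type*} [AddCommGroup V] [Module ℂ V] [FiniteDimensional ℂ V]

/-- The trace of `ρ(σ) ^ n` on the inertia invariants is the mean of the character over the
elements acting on the residue field as the `n`-th power of the Frobenius. This does not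
involve the choice of a Frobenius, and by conjugation it does not depend on the prime above `q`. -/
theorem hasPowerSums_localFactor (c : FrobeniusChoice K L) (ρ : Representation ℂ Gal(L/K) V)
    (q : HeightOneSpectrum (𝓞 K)) (P : HeightOneSpectrum (𝓞 L)) (hP : P.under (𝓞 K) = q) :
    HasPowerSums (localFactor c ρ q) fun n =>
      powerMean P.asIdeal (Nat.card (𝓞 K ⧸ q.asIdeal) ^ n) ρ.character := by
  have h := hasPowerSums_charpolyRev
    (LinearMap.toMatrix (Module.finBasis ℂ (inertiaInvariants c ρ q))
      (Module.finBasis ℂ (inertiaInvariants c ρ q)) (frobAction c ρ q))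
  have htr : (fun n => powerMean P.asIdeal (Nat.card (𝓞 K ⧸ q.asIdeal) ^ n) ρ.character) =
      fun n => LinearMap.trace ℂ _ (frobAction c ρ q ^ n) := by
    funext n
    rw [frobAction, trace_invariantsSubgroup,
      ← powerMean_eq_sum_inertia (pow_mem_powerSet (frob_mem_powerSet c q) n)]
    exact powerMean_eq_of_under_eq (hP.trans (c.under_prime q).symm) _ _ ρ.char_conj
  have hmat : (fun n => LinearMap.trace ℂ _ (frobAction c ρ q ^ n)) = fun n =>
      (LinearMap.toMatrix (Module.finBasis ℂ (inertiaInvariants c ρ q))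
        (Module.finBasis ℂ (inertiaInvariants c ρ q)) (frobAction c ρ q) ^ n).trace := by
    funext n
    rw [LinearMap.trace_eq_matrix_trace ℂ (Module.finBasis ℂ (inertiaInvariants c ρ q)),
      LinearMap.toMatrix_pow]
  rw [htr, hmat]
  exact h

end LocalFactor

/-! ### Towers of Galois extensions -/

section TowerMeans

open scoped Pointwise

section Restriction

variable {K L E : Type*} [Field K] [Field L] [Field E] [Algebra K L] [Algebra L E] [Algebra K E]
  [IsScalarTower K L E] [Normal K L]

theorem algebraMap_restrictNormalHom_smul (g : Gal(E/K)) (x : 𝓞 L) :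
    algebraMap (𝓞 L) (𝓞 E) (AlgEquiv.restrictNormalHom L g • x) =
      g • algebraMap (𝓞 L) (𝓞 E) x :=
  NumberField.RingOfIntegers.ext (AlgEquiv.restrictNormal_commutes g L (x : L))

/-- An automorphism of `E` over `K` that restricts to the identity on `L`, as an automorphism
over `L`. -/
def liftKer (g : Gal(E/K)) (hg : AlgEquiv.restrictNormalHom L g = 1) :
    Gal(E/L) :=
  AlgEquiv.ofRingEquiv (f := g.toRingEquiv) fun x => by
    have h := AlgEquiv.restrictNormal_commutes g L x
    have h1 : g.restrictNormal L = 1 := hg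
    rw [h1] at h
    exact h.symm

theorem restrictNormalHom_mem_powerSet {P : Ideal (𝓞 E)} {N : ℕ} {g : Gal(E/K)}
    (hg : g ∈ powerSet Gal(E/K) P N) :
    AlgEquiv.restrictNormalHom L g ∈ powerSet Gal(L/K) (P.under (𝓞 L)) N := by
  intro x
  rw [Ideal.mem_comap, map_sub, map_pow, algebraMap_restrictNormalHom_smul]
  exact hg _

theorem under_smul (P : Ideal (𝓞 E)) (g : Gal(E/K)) :
    (g • P).under (𝓞 L) = AlgEquiv.restrictNormalHom L g • P.under (𝓞 L) := by
  ext x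
  rw [Ideal.mem_pointwise_smul_iff_inv_smul_mem, Ideal.mem_comap, Ideal.mem_comap, ← map_inv,
    algebraMap_restrictNormalHom_smul, Ideal.mem_pointwise_smul_iff_inv_smul_mem]

end Restriction

variable {K L E : Type*} [Field K] [NumberField K] [Field L] [NumberField L]
  [Field E] [Algebra K L] [Algebra L E] [Algebra K E] [IsScalarTower K L E] [IsGalois K L]

theorem card_inertia_under (P : Ideal (𝓞 E)) [P.IsPrime] :
    Nat.card ((P.under (𝓞 L)).inertia Gal(L/K)) =
      (P.under (𝓞 K)).ramificationIdxIn (𝓞 L) := by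
  have h1 : (P.under (𝓞 L)).LiesOver (P.under (𝓞 K)) := ⟨(Ideal.under_under P).symm⟩
  exact Ideal.card_inertia_eq_ramificationIdxIn _ _

variable [NumberField E] [IsGalois L E] [IsGalois K E]

variable (K L) in
theorem card_inertia_tower (P : Ideal (𝓞 E)) [P.IsPrime] :
    Nat.card (P.inertia Gal(E/K)) = (P.under (𝓞 K)).ramificationIdxIn (𝓞 L) *
      Nat.card (P.inertia Gal(E/L)) := by
  have h1 : (P.under (𝓞 L)).LiesOver (P.under (𝓞 K)) := ⟨(Ideal.under_under P).symm⟩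
  have hne : Nonempty ((P.under (𝓞 L)).primesOver (𝓞 E)) := ⟨⟨P, inferInstance, ⟨rfl⟩⟩⟩
  rw [Ideal.card_inertia_eq_ramificationIdxIn (P.under (𝓞 K)) P,
    Ideal.card_inertia_eq_ramificationIdxIn (P.under (𝓞 L)) P]
  exact (Ideal.ramificationIdxIn_mul_ramificationIdxIn (P.under (𝓞 L)) Gal(L/K) (𝓞 E)
    Gal(E/K) Gal(E/L)).symm

variable (K L) in
/-- Restriction of the inertia group of `P` to the inertia group of the prime below `P`. -/
def inertiaRestrict (P : Ideal (𝓞 E)) :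
    P.inertia Gal(E/K) →* (P.under (𝓞 L)).inertia Gal(L/K) :=
  ((AlgEquiv.restrictNormalHom L).comp (P.inertia Gal(E/K)).subtype).codRestrict _ fun g => by
    have h : (g : Gal(E/K)) ∈ powerSet Gal(E/K) P 1 := by rw [powerSet_one]; exact g.2
    have := restrictNormalHom_mem_powerSet (L := L) h
    rwa [powerSet_one] at this

/-- The kernel of the restriction is contained in the inertia group of `P` in `Gal(E/L)`, so
surjectivity follows from the multiplicativity of ramification indices. -/
theorem inertiaRestrict_surjective (P : Ideal (𝓞 E)) [P.IsPrime] :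
    Function.Surjective (inertiaRestrict K L P) := by
  refine MonoidHom.surjective_of_card_ker_le_div _ ?_
  -- it suffices that the kernel has at most as many elements as the inertia group in `Gal(E/L)`
  rw [card_inertia_tower K L P, card_inertia_under P, Nat.mul_div_cancel_left]
  · have hres : ∀ g : (inertiaRestrict K L P).ker,
        AlgEquiv.restrictNormalHom L (g.1.1 : Gal(E/K)) = 1 := fun g =>
      congrArg Subtype.val g.2
    refine Nat.card_le_card_of_injective
      (fun g : (inertiaRestrict K L P).ker =>
        (⟨liftKer g.1.1 (hres g), fun x => g.1.2 x⟩ : P.inertia Gal(E/L))) fun g h hgh => ?_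
    refine Subtype.ext (Subtype.ext (AlgEquiv.ext fun x => ?_))
    exact DFunLike.congr_fun (congrArg Subtype.val hgh) x
  · rw [← card_inertia_under (K := K) (L := L) P]
    exact Nat.card_pos

/-- Means are unchanged by inflation. -/
theorem powerMean_comp_restrictNormalHom (P : Ideal (𝓞 E)) [P.IsPrime] {N : ℕ} {σ : Gal(E/K)}
    (hσ : σ ∈ powerSet Gal(E/K) P N) (χ : Gal(L/K) → ℂ) :
    powerMean P N (fun g : Gal(E/K) => χ (AlgEquiv.restrictNormalHom L g)) =
      powerMean (P.under (𝓞 L)) N χ := by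
  classical
  rw [powerMean_eq_sum_inertia hσ,
    powerMean_eq_sum_inertia (restrictNormalHom_mem_powerSet (L := L) hσ)]
  have h := sum_comp_surjective (inertiaRestrict K L P) (inertiaRestrict_surjective P)
    fun s => χ (s * AlgEquiv.restrictNormalHom L σ)
  have h1 := sum_coe_eq_sum_indicator (P.inertia Gal(E/K) : Set Gal(E/K)) fun g =>
    χ (AlgEquiv.restrictNormalHom L (g * σ))
  have h2 := sum_coe_eq_sum_indicator ((P.under (𝓞 L)).inertia Gal(L/K) : Set Gal(L/K)) fun s =>
    χ (s * AlgEquiv.restrictNormalHom L σ)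
  rw [← h1, ← h2]
  simp only [map_mul]
  refine (congrArg _ h).trans ?_
  have h0 : (Nat.card (P.inertia Gal(E/K)) : ℂ) ≠ 0 := Nat.cast_ne_zero.mpr Nat.card_pos.ne'
  rw [← mul_assoc, mul_div_assoc', inv_mul_cancel₀ h0, one_div]
  rfl

end TowerMeans

/-- If an element of `Gal(E/L)` acts on the residue field of `P` as the `n`-th power of the
Frobenius of `K`, then the residue degree of `L/K` divides `n`. -/
theorem inertiaDeg_dvd_of_mem_powerSet {K L E : Type*} [Field K] [NumberField K] [Field L]
    [NumberField L] [Field E] [NumberField E] [Algebra K L] [Algebra L E] [IsGalois L E]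
    (P : Ideal (𝓞 E)) (p : Ideal (𝓞 L)) (q : Ideal (𝓞 K))
    [P.LiesOver p] [p.LiesOver q] [p.IsMaximal] [q.IsMaximal] {n : ℕ} {g : Gal(E/L)}
    (hg : g ∈ powerSet Gal(E/L) P (Nat.card (𝓞 K ⧸ q) ^ n))
    (hq : Finite (𝓞 K ⧸ q)) (hp : Finite (𝓞 L ⧸ p)) : p.inertiaDeg (𝓞 K) ∣ n := by
  let _ : Field (𝓞 K ⧸ q) := Ideal.Quotient.field q
  let _ : Field (𝓞 L ⧸ p) := Ideal.Quotient.field p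
  let _ : Fintype (𝓞 K ⧸ q) := Fintype.ofFinite _
  -- `f` is the order of the `#(𝓞 K / q)`-power map on `𝓞 L / p`, and `g` fixes `𝓞 L`
  have hfr : Module.finrank (𝓞 K ⧸ q) (𝓞 L ⧸ p) = p.inertiaDeg (𝓞 K) := by
    have h1 : Nat.card (𝓞 K ⧸ q) ^ p.inertiaDeg (𝓞 K) = Nat.card (𝓞 L ⧸ p) :=
      Ideal.cardQuot_pow_inertiaDeg q p
    have h2 : Nat.card (𝓞 L ⧸ p) = Nat.card (𝓞 K ⧸ q) ^ _ := Module.natCard_eq_pow_finrank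
    exact (Nat.pow_right_injective Finite.one_lt_card (h1.trans h2)).symm
  rw [← hfr, ← FiniteField.orderOf_frobeniusAlgHom, orderOf_dvd_iff_pow_eq_one]
  ext x
  obtain ⟨x, rfl⟩ := Ideal.Quotient.mk_surjective x
  rw [AlgHom.coe_pow, FiniteField.coe_frobeniusAlgHom, pow_iterate, AlgHom.one_apply]
  beta_reduce
  rw [← Nat.card_eq_fintype_card, ← map_pow, eq_comm, Ideal.Quotient.eq, Ideal.over_def P p,
    Ideal.mem_comap, map_sub, map_pow]
  have h := hg (algebraMap (𝓞 L) (𝓞 E) x)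
  rwa [smul_algebraMap] at h

/-! ### Means of induced characters -/

section Induction

open scoped Pointwise

/-- The prime `g • P`. -/
def smulPrime {R G : Type*} [CommRing R] [Group G] [MulSemiringAction G R] (g : G)
    (P : HeightOneSpectrum R) : HeightOneSpectrum R where
  asIdeal := g • P.asIdeal
  isPrime := inferInstance
  ne_bot h := P.ne_bot (by rw [← inv_smul_smul g P.asIdeal, h, Ideal.smul_bot])

/-- The sum of a function of the primes above `q` over a Galois orbit: each prime is reached
`e f` times. -/
theorem sum_smulPrime {K L : Type*} [Field K] [NumberField K] [Field L] [NumberField L]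
    [Algebra K L] [IsGalois K L] (q : HeightOneSpectrum (𝓞 K)) (p₀ : HeightOneSpectrum (𝓞 L))
    (hp₀ : p₀.under (𝓞 K) = q) (F : HeightOneSpectrum (𝓞 L) → ℂ) :
    ∑ s : Gal(L/K), F (smulPrime s p₀) =
      (q.asIdeal.ramificationIdxIn (𝓞 L) * q.asIdeal.inertiaDegIn (𝓞 L) : ℕ) *
        ∑ p ∈ (finite_under_fiber K L q).toFinset, F p := by
  classical
  have := liesOver_of_under_eq hp₀
  have hmaps : ∀ s ∈ (Finset.univ : Finset Gal(L/K)),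
      smulPrime s p₀ ∈ (finite_under_fiber K L q).toFinset := by
    intro s _
    rw [Set.Finite.mem_toFinset]
    exact HeightOneSpectrum.ext
      (Ideal.over_def (s • p₀.asIdeal) q.asIdeal).symm
  rw [← Finset.sum_fiberwise_of_maps_to hmaps, Finset.mul_sum]
  refine Finset.sum_congr rfl fun p hp => ?_
  rw [Finset.sum_congr rfl (g := fun _ => F p)
    (fun s hs => by rw [(Finset.mem_filter.mp hs).2]), Finset.sum_const, nsmul_eq_mul,
    ← Ideal.card_stabilizer_eq (G := Gal(L/K)) q.asIdeal p₀.asIdeal]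
  congr 2
  rw [Set.Finite.mem_toFinset] at hp
  have := liesOver_of_under_eq hp
  obtain ⟨s₀, hs₀⟩ := Ideal.exists_smul_eq_of_isGaloisGroup q.asIdeal p₀.asIdeal p.asIdeal Gal(L/K)
  rw [← Fintype.card_subtype, ← Nat.card_eq_fintype_card]
  refine Nat.card_congr ((Equiv.mulLeft s₀⁻¹).subtypeEquiv fun s => ?_)
  rw [Equiv.coe_mulLeft, MulAction.mem_stabilizer_iff, mul_smul, inv_smul_eq_iff, hs₀]
  exact ⟨congrArg HeightOneSpectrum.asIdeal, fun h => HeightOneSpectrum.ext h⟩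

variable {K L E : Type*} [Field K] [NumberField K] [Field L] [NumberField L]
  [Field E] [NumberField E] [Algebra K L] [Algebra L E] [Algebra K E] [IsScalarTower K L E]
  [IsGalois K L] [IsGalois L E] [IsGalois K E]
  {U : Type*} [AddCommGroup U] [Module ℂ U] [FiniteDimensional ℂ U]

/-- The mean of an induced character as a sum over the conjugates of `P`. The elements of
`Gal(E/L)` contributing to the summand at `t` are those lying, as elements of `Gal(E/K)`, in
`powerSet` for `t • P`. -/
theorem powerMean_induction_eq_sum_smul (P : Ideal (𝓞 E)) [P.IsPrime] (N : ℕ)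
    (ρ₀ : Representation ℂ Gal(E/L) U) :
    powerMean P N (induction K L E ρ₀).character =
      ((P.under (𝓞 K)).ramificationIdxIn (𝓞 L) * Nat.card Gal(E/L) : ℂ)⁻¹ *
        ∑ t : Gal(E/K), powerMean (t • P) N ρ₀.character := by
  classical
  have hsum : ∑ x, (powerSet Gal(E/K) P N).indicator (induction K L E ρ₀).character x =
      (Nat.card Gal(E/L) : ℂ)⁻¹ * ∑ t : Gal(E/K), ∑ h : Gal(E/L),
        (powerSet Gal(E/L) (t • P) N).indicator ρ₀.character h := by
    have hx : ∀ x, (powerSet Gal(E/K) P N).indicator (induction K L E ρ₀).character x =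
        (Nat.card Gal(E/L) : ℂ)⁻¹ * ∑ h : Gal(E/L), ∑ t : Gal(E/K),
          if t⁻¹ * AlgEquiv.restrictScalarsHom K h * t = x then
            (powerSet Gal(E/K) P N).indicator (fun _ => ρ₀.character h) x else 0 := by
      intro x
      by_cases hx : x ∈ powerSet Gal(E/K) P N
      · simp only [Set.indicator_of_mem hx]
        exact character_ind _ _ _
      · simp [Set.indicator_of_notMem hx]
    simp_rw [hx]
    rw [← Finset.mul_sum, Finset.sum_comm]
    congr 1
    conv_rhs => rw [Finset.sum_comm]
    refine Finset.sum_congr rfl fun h _ => ?_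
    rw [Finset.sum_comm]
    refine Finset.sum_congr rfl fun t _ => ?_
    rw [Finset.sum_ite_eq, if_pos (Finset.mem_univ _)]
    simp only [Set.indicator_apply, ← mem_powerSet_smul_iff]
    rfl
  have hcard : ∀ t : Gal(E/K), (Nat.card (P.inertia Gal(E/K)) : ℂ) =
      (P.under (𝓞 K)).ramificationIdxIn (𝓞 L) * Nat.card ((t • P).inertia Gal(E/L)) := by
    intro t
    rw [← card_inertia_smul P t, card_inertia_tower K L (t • P), Nat.cast_mul,
      ← Ideal.over_def (t • P) (P.under (𝓞 K))]
  have h0 : (Nat.card (P.inertia Gal(E/K)) : ℂ) ≠ 0 := Nat.cast_ne_zero.mpr Nat.card_pos.ne'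
  have he : ((P.under (𝓞 K)).ramificationIdxIn (𝓞 L) : ℂ) ≠ 0 := fun h =>
    h0 (by rw [hcard 1, h, zero_mul])
  rw [powerMean, hsum, mul_inv, Finset.mul_sum, Finset.mul_sum, Finset.mul_sum]
  refine Finset.sum_congr rfl fun t _ => ?_
  have ht : (Nat.card ((t • P).inertia Gal(E/L)) : ℂ) ≠ 0 := Nat.cast_ne_zero.mpr Nat.card_pos.ne'
  rw [powerMean, hcard t]
  field_simp

/-- The mean of an induced character at a prime `P` above `q` is the sum of the means of the
original character at primes `T p` above the primes `p` of `L` above `q`, times the residue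
degree of `L/K` at `q`. -/
theorem powerMean_induction (q : HeightOneSpectrum (𝓞 K)) (P : HeightOneSpectrum (𝓞 E))
    (hP : P.under (𝓞 K) = q) (N : ℕ) (ρ₀ : Representation ℂ Gal(E/L) U)
    (T : HeightOneSpectrum (𝓞 L) → HeightOneSpectrum (𝓞 E)) (hT : ∀ p, (T p).under (𝓞 L) = p) :
    powerMean P.asIdeal N (induction K L E ρ₀).character =
      q.asIdeal.inertiaDegIn (𝓞 L) *
        ∑ p ∈ (finite_under_fiber K L q).toFinset, powerMean (T p).asIdeal N ρ₀.character := by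
  set p₀ := P.under (𝓞 L)
  have hp₀ : p₀.under (𝓞 K) = q := by
    rw [← hP]; exact HeightOneSpectrum.ext (Ideal.under_under P.asIdeal)
  have hq : P.asIdeal.under (𝓞 K) = q.asIdeal := congrArg HeightOneSpectrum.asIdeal hP
  rw [powerMean_induction_eq_sum_smul, hq]
  -- a mean for `Gal(E/L)` at `t • P` depends only on the prime of `L` below
  have ht : ∀ t : Gal(E/K), powerMean (t • P.asIdeal) N ρ₀.character =
      powerMean (T (smulPrime (AlgEquiv.restrictNormalHom L t) p₀)).asIdeal N ρ₀.character := by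
    intro t
    refine powerMean_eq_of_under_eq (P := smulPrime t P) ?_ N _ ρ₀.char_conj
    rw [hT]
    exact HeightOneSpectrum.ext (under_smul P.asIdeal t)
  simp_rw [ht]
  rw [sum_comp_surjective (AlgEquiv.restrictNormalHom (F := K) (K₁ := E) L)
      (AlgEquiv.restrictNormalHom_surjective E)
      (fun s => powerMean (T (smulPrime s p₀)).asIdeal N ρ₀.character),
    sum_smulPrime q p₀ hp₀ fun p => powerMean (T p).asIdeal N ρ₀.character]
  -- the factor is `[L : K]⁻¹ [E : K] [E : L]⁻¹ e⁻¹ (e f) = f`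
  have hcard : (Nat.card Gal(E/K) : ℂ) = Nat.card Gal(L/K) * Nat.card Gal(E/L) := by
    rw [IsGalois.card_aut_eq_finrank, IsGalois.card_aut_eq_finrank, IsGalois.card_aut_eq_finrank,
      ← Module.finrank_mul_finrank K L E, Nat.cast_mul]
  have h1 : (Nat.card Gal(L/K) : ℂ) ≠ 0 := Nat.cast_ne_zero.mpr Nat.card_pos.ne'
  have h2 : (Nat.card Gal(E/L) : ℂ) ≠ 0 := Nat.cast_ne_zero.mpr Nat.card_pos.ne'
  have he : (q.asIdeal.ramificationIdxIn (𝓞 L) : ℂ) ≠ 0 := by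
    rw [← hq, ← card_inertia_under (L := L) P.asIdeal]
    exact Nat.cast_ne_zero.mpr Nat.card_pos.ne'
  rw [hcard]
  push_cast
  field_simp

end Induction

/-! ### Identities between local factors -/

section LocalPoly

/-- A polynomial over `ℚ^ab` is the local factor if it has the right power sums over `ℂ`. -/
theorem eq_localPoly {K L V : Type*} [Field K] [NumberField K] [Field L] [NumberField L]
    [Algebra K L] [IsGalois K L] [AddCommGroup V] [Module ℂ V] [FiniteDimensional ℂ V]
    (c : FrobeniusChoice K L) (ρ : Representation ℂ Gal(L/K) V) (q : HeightOneSpectrum (𝓞 K))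
    (P : HeightOneSpectrum (𝓞 L)) (hP : P.under (𝓞 K) = q) {F : QAb[X]} (hF : F.coeff 0 = 1)
    (h : HasPowerSums (F.map (algebraMap QAb ℂ)) fun n =>
      powerMean P.asIdeal (Nat.card (𝓞 K ⧸ q.asIdeal) ^ n) ρ.character) :
    F = localPoly c ρ q := by
  apply Polynomial.map_injective _ (algebraMap QAb ℂ).injective
  rw [map_localPoly]
  refine h.unique (hasPowerSums_localFactor c ρ q P hP) (by simp [hF]) ?_
  rw [← map_localPoly, Polynomial.coeff_map, coeff_zero_localPoly, map_one]

theorem hasPowerSums_map_localPoly {K L V : Type*} [Field K] [NumberField K] [Field L]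
    [NumberField L] [Algebra K L] [IsGalois K L] [AddCommGroup V] [Module ℂ V]
    [FiniteDimensional ℂ V] (c : FrobeniusChoice K L) (ρ : Representation ℂ Gal(L/K) V)
    (q : HeightOneSpectrum (𝓞 K)) (P : HeightOneSpectrum (𝓞 L)) (hP : P.under (𝓞 K) = q) :
    HasPowerSums ((localPoly c ρ q).map (algebraMap QAb ℂ)) fun n =>
      powerMean P.asIdeal (Nat.card (𝓞 K ⧸ q.asIdeal) ^ n) ρ.character := by
  rw [map_localPoly]
  exact hasPowerSums_localFactor c ρ q P hP

theorem localPoly_prod {K L V W : Type*} [Field K] [NumberField K] [Field L] [NumberField L]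
    [Algebra K L] [IsGalois K L] [AddCommGroup V] [Module ℂ V] [FiniteDimensional ℂ V]
    [AddCommGroup W] [Module ℂ W] [FiniteDimensional ℂ W]
    (c c' c'' : FrobeniusChoice K L) (ρ : Representation ℂ Gal(L/K) V)
    (γ : Representation ℂ Gal(L/K) W) (q : HeightOneSpectrum (𝓞 K)) :
    localPoly c ρ q * localPoly c' γ q = localPoly c'' (ρ.prod γ) q := by
  have hP := c.under_prime q
  refine eq_localPoly c'' _ q (c.prime q) hP
    (by rw [Polynomial.mul_coeff_zero, coeff_zero_localPoly, coeff_zero_localPoly, mul_one]) ?_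
  rw [Polynomial.map_mul]
  have hχ : (ρ.prod γ).character = ρ.character + γ.character :=
    funext fun g => LinearMap.trace_prodMap' _ _
  simp_rw [hχ, powerMean_add]
  exact (hasPowerSums_map_localPoly c ρ q _ hP).mul (hasPowerSums_map_localPoly c' γ q _ hP)

theorem under_under_heightOne {K L E : Type*} [Field K] [Field L] [NumberField L] [Field E]
    [NumberField E] [Algebra K L] [Algebra L E] [Algebra K E] [IsScalarTower K L E]
    (P : HeightOneSpectrum (𝓞 E)) :
    (P.under (𝓞 L)).under (𝓞 K) = P.under (𝓞 K) :=
  HeightOneSpectrum.ext (Ideal.under_under P.asIdeal)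

variable {K L E : Type*} [Field K] [NumberField K] [Field L] [NumberField L]
  [Field E] [NumberField E] [Algebra K L] [Algebra L E] [Algebra K E] [IsScalarTower K L E]
  [IsGalois K L] [IsGalois K E] [IsGalois L E]

theorem localPoly_inflation {V : Type*} [AddCommGroup V] [Module ℂ V] [FiniteDimensional ℂ V]
    (c : FrobeniusChoice K L) (d : FrobeniusChoice K E) (ρ : Representation ℂ Gal(L/K) V)
    (q : HeightOneSpectrum (𝓞 K)) :
    localPoly c ρ q = localPoly d (inflation K L E ρ) q := by
  refine eq_localPoly d _ q (d.prime q) (d.under_prime q) (coeff_zero_localPoly c ρ q) ?_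
  have h := hasPowerSums_map_localPoly c ρ q ((d.prime q).under (𝓞 L))
    ((under_under_heightOne _).trans (d.under_prime q))
  convert h using 2 with n
  exact powerMean_comp_restrictNormalHom (d.prime q).asIdeal
    (pow_mem_powerSet (frob_mem_powerSet d q) n) ρ.character

theorem localPoly_induction {U : Type*} [AddCommGroup U] [Module ℂ U] [FiniteDimensional ℂ U]
    (b : FrobeniusChoice L E) (d : FrobeniusChoice K E) (ρ₀ : Representation ℂ Gal(E/L) U)
    (q : HeightOneSpectrum (𝓞 K)) :
    ∏ p ∈ (finite_under_fiber K L q).toFinset,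
        Polynomial.expand QAb (p.asIdeal.inertiaDeg (𝓞 K)) (localPoly b ρ₀ p) =
      localPoly d (induction K L E ρ₀) q := by
  have hpos : ∀ p : HeightOneSpectrum (𝓞 L), 0 < p.asIdeal.inertiaDeg (𝓞 K) :=
    fun p => Ideal.inertiaDeg_pos _ _
  refine eq_localPoly d _ q (d.prime q) (d.under_prime q) ?_ ?_
  · rw [Polynomial.coeff_zero_prod]
    refine Finset.prod_eq_one fun p _ => ?_
    rw [Polynomial.coeff_expand (hpos p), if_pos (dvd_zero _), Nat.zero_div, coeff_zero_localPoly]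
  rw [Polynomial.map_prod]
  have h := HasPowerSums.prod (finite_under_fiber K L q).toFinset fun p _ =>
    (hasPowerSums_map_localPoly b ρ₀ p (b.prime p) (b.under_prime p)).expand (hpos p).ne'
  simp_rw [← Polynomial.map_expand] at h
  refine Eq.mp (congrArg (HasPowerSums _) (funext fun n => Eq.symm ?_)) h
  rw [powerMean_induction q (d.prime q) (d.under_prime q) _ ρ₀ b.prime b.under_prime,
    Finset.mul_sum]
  refine Finset.sum_congr rfl fun p hp => ?_
  rw [Set.Finite.mem_toFinset] at hp
  have hpq := liesOver_of_under_eq hp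
  have hPp := liesOver_of_under_eq (b.under_prime p)
  have := p.isMaximal
  have := q.isMaximal
  rw [Ideal.inertiaDegIn_eq_inertiaDeg q.asIdeal p.asIdeal Gal(L/K)]
  -- `#(𝓞 L / p) = #(𝓞 K / q) ^ f`, so the exponent `n` for `q` is the exponent `n / f` for `p`
  split_ifs with hn
  · have hcard : Nat.card (𝓞 K ⧸ q.asIdeal) ^ p.asIdeal.inertiaDeg (𝓞 K) =
        Nat.card (𝓞 L ⧸ p.asIdeal) := Ideal.cardQuot_pow_inertiaDeg q.asIdeal p.asIdeal
    rw [← hcard, ← pow_mul, Nat.mul_div_cancel' hn]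
  · have hempty : powerSet Gal(E/L) (b.prime p).asIdeal (Nat.card (𝓞 K ⧸ q.asIdeal) ^ n) = ∅ :=
      Set.eq_empty_of_forall_notMem fun g hg => hn (inertiaDeg_dvd_of_mem_powerSet
        (b.prime p).asIdeal p.asIdeal q.asIdeal hg inferInstance inferInstance)
    simp [powerMean, hempty]

end LocalPoly

/-! ### Euler products -/

section EulerProducts

open scoped MvPowerSeries.WithPiTopology

variable {P k : Type*} [Field k]

theorem constantCoeff_aeval_X_ne_zero {σ : Type*} {p : k[X]} (hp : p.coeff 0 = 1) (v : σ) :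
    MvPowerSeries.constantCoeff
      (Polynomial.aeval (MvPowerSeries.X v : MvPowerSeries σ k) p) ≠ 0 := by
  rw [constantCoeff_aeval_X, hp]
  exact one_ne_zero

theorem eulerProd_mul {f g : P → k[X]} (hf : ∀ q, (f q).coeff 0 = 1)
    (hg : ∀ q, (g q).coeff 0 = 1) :
    eulerProd f * eulerProd g = eulerProd fun q => f q * g q := by
  let _ : TopologicalSpace k := ⊥
  have : DiscreteTopology k := ⟨rfl⟩
  unfold eulerProd
  rw [← (multipliable_eulerProd hf).tprod_mul (multipliable_eulerProd hg)]
  refine tprod_congr fun v => ?_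
  rw [map_mul, MvPowerSeries.mul_inv_rev, mul_comm]

theorem inv_finset_prod {σ ι : Type*} (s : Finset ι) (F : ι → MvPowerSeries σ k) :
    (∏ i ∈ s, F i)⁻¹ = ∏ i ∈ s, (F i)⁻¹ := by
  classical
  induction s using Finset.induction_on with
  | empty => simp
  | insert i s hi ih =>
    rw [Finset.prod_insert hi, Finset.prod_insert hi, MvPowerSeries.mul_inv_rev, ih, mul_comm]

/-- A substitution `x_i^{(p)} ↦ (x_i^{(π p)}) ^ e p` turns an Euler product into another one, by
collecting the factors in each fiber of `π`. -/
theorem subst_eulerProd {Q : Type*} {π : P → Q} (hπ : ∀ q, {p | π p = q}.Finite) {e : P → ℕ}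
    (ha : MvPowerSeries.HasSubst fun v : P × ℕ =>
      (MvPowerSeries.X (π v.1, v.2) ^ e v.1 : MvPowerSeries (Q × ℕ) k))
    (he : ∀ p, e p ≠ 0) {f : P → k[X]} (hf : ∀ p, (f p).coeff 0 = 1) :
    MvPowerSeries.substAlgHom (R := k) ha (eulerProd f) =
      eulerProd fun q => ∏ p ∈ (hπ q).toFinset, Polynomial.expand k (e p) (f p) := by
  let _ : TopologicalSpace k := ⊥
  have : DiscreteTopology k := ⟨rfl⟩
  set φ := MvPowerSeries.substAlgHom (R := k) ha
  have hcont : Continuous φ := by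
    let _ : UniformSpace k := ⊥
    have : DiscreteUniformity k := ⟨rfl⟩
    rw [MvPowerSeries.coe_substAlgHom]
    exact MvPowerSeries.continuous_subst ha
  have hfactor : ∀ v : P × ℕ, φ (Polynomial.aeval (MvPowerSeries.X v) (f v.1))⁻¹ =
      (Polynomial.aeval (MvPowerSeries.X (π v.1, v.2) : MvPowerSeries (Q × ℕ) k)
        (Polynomial.expand k (e v.1) (f v.1)))⁻¹ := by
    intro v
    have h1 := constantCoeff_aeval_X_ne_zero (hf v.1) v
    have h2 : (Polynomial.expand k (e v.1) (f v.1)).coeff 0 = 1 := by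
      rw [Polynomial.coeff_expand (Nat.pos_of_ne_zero (he _)), if_pos (dvd_zero _), Nat.zero_div,
        hf]
    rw [MvPowerSeries.eq_inv_iff_mul_eq_one (constantCoeff_aeval_X_ne_zero h2 _)]
    have h3 : φ (Polynomial.aeval (MvPowerSeries.X v) (f v.1)) =
        Polynomial.aeval (MvPowerSeries.X (π v.1, v.2) : MvPowerSeries (Q × ℕ) k)
          (Polynomial.expand k (e v.1) (f v.1)) := by
      rw [← Polynomial.aeval_algHom_apply, Polynomial.expand_aeval, MvPowerSeries.substAlgHom_X]
    rw [← h3, ← map_mul, MvPowerSeries.inv_mul_cancel _ h1, map_one]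
  have hmul : HasProd (fun v : P × ℕ => (Polynomial.aeval (MvPowerSeries.X v) (f v.1))⁻¹)
      (eulerProd f) := (multipliable_eulerProd hf).hasProd
  have hmem : ∀ (w : Q × ℕ) (v : P × ℕ), (π v.1, v.2) = w ↔ π v.1 = w.1 ∧ v.2 = w.2 :=
    fun w v => Prod.ext_iff
  -- the variables `x_i^{(p)}` that are sent to a power of the variable `w`
  let ε (w : Q × ℕ) : {p // p ∈ (hπ w.1).toFinset} ≃ {v : P × ℕ // (π v.1, v.2) = w} :=
    { toFun := fun p => ⟨(p.1, w.2), (hmem w _).mpr ⟨(hπ w.1).mem_toFinset.mp p.2, rfl⟩⟩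
      invFun := fun v => ⟨v.1.1, (hπ w.1).mem_toFinset.mpr ((hmem w _).mp v.2).1⟩
      left_inv := fun p => rfl
      right_inv := fun v => Subtype.ext (Prod.ext rfl ((hmem w _).mp v.2).2.symm) }
  have hsigma := (Equiv.sigmaFiberEquiv fun v : P × ℕ => (π v.1, v.2)).hasProd_iff.mpr
    (hmul.map φ hcont)
  have : RegularSpace (MvPowerSeries (Q × ℕ) k) :=
    inferInstanceAs (RegularSpace ((Q × ℕ →₀ ℕ) → k))
  refine (HasProd.tprod_eq (hsigma.sigma fun w => ?_)).symm
  rw [← (ε w).hasProd_iff, map_prod, inv_finset_prod, ← Finset.prod_coe_sort]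
  refine (hasProd_fintype _).congr_fun fun p => (hfactor _).trans ?_
  have hp : π p.1 = w.1 := (hπ w.1).mem_toFinset.mp p.2
  have hw : (π p.1, w.2) = w := Prod.ext hp rfl
  change (Polynomial.aeval (MvPowerSeries.X (π p.1, w.2)) _)⁻¹ = _
  rw [hw]
  rfl

end EulerProducts

end ArithSym

end

theorem mainTheorem5 {K L E : Type*} [Field K] [NumberField K] [Field L] [NumberField L]
    [Field E] [NumberField E] [Algebra K L] [Algebra L E] [Algebra K E] [IsScalarTower K L E]
    [IsGalois K L] [IsGalois L E] [IsGalois K E]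
    {V W U : Type*} [AddCommGroup V] [Module ℂ V] [FiniteDimensional ℂ V]
    [AddCommGroup W] [Module ℂ W] [FiniteDimensional ℂ W]
    [AddCommGroup U] [Module ℂ U] [FiniteDimensional ℂ U]
    (ρ : Representation ℂ Gal(L/K) V) (γ : Representation ℂ Gal(L/K) W)
    (ρ₀ : Representation ℂ Gal(E/L) U) :
    (∀ c c' c'' : ArithSym.FrobeniusChoice K L,
      ArithSym.artinSym c ρ * ArithSym.artinSym c' γ = ArithSym.artinSym c'' (ρ.prod γ)) ∧
    (∀ (c : ArithSym.FrobeniusChoice K L) (d : ArithSym.FrobeniusChoice K E),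
      ArithSym.artinSym c ρ = ArithSym.artinSym d (ArithSym.inflation K L E ρ)) ∧
    (∀ (b : ArithSym.FrobeniusChoice L E) (d : ArithSym.FrobeniusChoice K E),
      ArithSym.normMap K L (ArithSym.artinSym b ρ₀) =
        ArithSym.artinSym d (ArithSym.induction K L E ρ₀)) := by
  refine ⟨fun c c' c'' => Subtype.ext ?_, fun c d => Subtype.ext ?_, fun b d => Subtype.ext ?_⟩
  · refine (ArithSym.eulerProd_mul (ArithSym.coeff_zero_localPoly c ρ)
      (ArithSym.coeff_zero_localPoly c' γ)).trans ?_
    exact congrArg ArithSym.eulerProd (funext (ArithSym.localPoly_prod c c' c'' ρ γ))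
  · exact congrArg ArithSym.eulerProd (funext (ArithSym.localPoly_inflation c d ρ))
  · refine (ArithSym.subst_eulerProd (ArithSym.finite_under_fiber K L)
      (ArithSym.hasSubst_normSubst K L) (fun p => (Ideal.inertiaDeg_pos _ _).ne')
      (ArithSym.coeff_zero_localPoly b ρ₀)).trans ?_
    exact congrArg ArithSym.eulerProd (funext (ArithSym.localPoly_induction b d ρ₀))
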